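/- Let $\mathcal M,\mathcal N$ be finite-dimensional Hadamard manifolds (complete, simply connected Riemannian manifolds of non-positive sectional curvature) with distance $d$, and let $\mathcal X\subset\mathcal M$, $\mathcal Y\subset\mathcal N$ be nonempty closed geodesically convex subsets. Let $\bar\mu_x,\bar\mu_y>0$ and $\bar L_x,\bar L_y,\bar L_{xy}\ge 0$, and let $g:\mathcal M\times\mathcal N\to\mathbb R$ be a differentiable function such that for all $(x,y)\in\mathcal X\times\mathcal Y$: - $g(\cdot,y)$ is $\bar\mu_x$-strongly g-convex in $\mathcal X$ and $g(x,\cdot)$ is $\bar\mu_y$-strongly g-concave in $\mathcal Y$, where a differentiable $f$ is $\mu$-strongly g-convex in $\mathcal X$ if $f(q)\ge f(p)+\langle\nabla f(p),\exp_p^{-1}(q)\rangle+\frac{\mu}{2}d^2(p,q)$ for all $p,q\in\mathcal X$, and $\mu$-strongly g-concave if $-f$ is $\mu$-strongly g-convex; - $\nabla_x g(\cdot,y)$ is $\bar L_x$-Lipschitz in $\mathcal X$ and $\nabla_y g(x,\cdot)$ is $\bar L_y$-Lipschitz in $\mathcal Y$, where gradients at different points are compared by parallel transport along the geodesic joining them;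 - $\nabla_y g(\cdot,y)$ is $\bar L_{xy}$-Lipschitz in $\mathcal X$ and $\nabla_x g(x,\cdot)$ is $\bar L_{xy}$-Lipschitz in $\mathcal Y$. Then for every $y\in\mathcal Y$ the function $g(\cdot,y)$ has a unique minimizer $x^*(y)$ over $\mathcal X$, for every $x\in\mathcal X$ the function $g(x,\cdot)$ has a unique maximizer $y^*(x)$ over $\mathcal Y$, and $g$ has a unique saddle point $(x^*,y^*)$ in $\mathcal X\times\mathcal Y$. For $(\bar x,\bar y)\in\mathcal X\times\mathcal Y$ put $$\mathrm{gap}(\bar x,\bar y)=\max_{y\in\mathcal Y}g(\bar x,y)-\min_{x\in\mathcal X}g(x,\bar y),\quad \mathrm{gap}_x(\bar x)=g(\bar x,y^*(\bar x))-g(x^*,y^*),\quad \mathrm{gap}_y(\bar y)=g(x^*,y^*)-g(x^*(\bar y),\bar y).$$ Then for all $(\bar x,\bar y)\in\mathcal X\times\mathcal Y$: 1. $\mathrm{gap}_x(\bar x)\le\mathrm{gap}(\bar x,\bar y)$ and $\mathrm{gap}_y(\bar y)\le\mathrm{gap}(\bar x,\bar y)$. 2. $d^2(\bar x,x^*)\le\frac{2}{\bar\mu_x}\mathrm{gap}_x(\bar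 x)$ and $d^2(\bar y,y^*)\le\frac{2}{\bar\mu_y}\mathrm{gap}_y(\bar y)$. 3. If $\mathrm{gap}_y(\bar y)\le\epsilon$ and $\bar x'\in\mathcal X$ is an $\hat\epsilon$-minimizer of $g(\cdot,\bar y)$ over $\mathcal X$, that is, $g(\bar x',\bar y)\le\min_{x\in\mathcal X}g(x,\bar y)+\hat\epsilon$, then $$d^2(\bar x',x^*)+d^2(\bar y,y^*)\le\frac{4\hat\epsilon}{\bar\mu_x}+\frac{2\epsilon}{\bar\mu_y}\Big(\frac{2\bar L_{xy}^2}{\bar\mu_x^2}+1\Big).$$ 4. If $x\mapsto g(x,\bar y)$ is $\bar L_p^x$-Lipschitz in $\mathcal X$ and $y\mapsto g(\bar x,y)$ is $\bar L_p^y$-Lipschitz in $\mathcal Y$ (with $\bar L_p^x,\bar L_p^y\ge 0$), then $$\mathrm{gap}(\bar x,\bar y)\le d(y^*,\bar y)\Big(\bar L_p^y+\bar L_p^x\frac{\bar L_{xy}}{\bar\mu_x}\Big)+d(x^*,\bar x)\Big(\bar L_p^x+\bar L_p^y\frac{\bar L_{xy}}{\bar\mu_y}\Big).$$ -/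

import Mathlib

open Set Manifold Bundle
open scoped ContDiff NNReal

namespace RiemannianMinMax

noncomputable section

section OneManifold

variable {E : Type*} [NormedAddCommGroup E] [NormedSpace ℝ E] [FiniteDimensional ℝ E]
  {M : Type*} [MetricSpace M] [ChartedSpace E M] [IsManifold 𝓘(ℝ, E) ∞ M]
  [RiemannianBundle (fun x : M ↦ TangentSpace 𝓘(ℝ, E) x)]

/-- The velocity `γ'(t) ∈ T_{γ(t)} M` of a curve `γ` parametrized by `[0, 1]`. -/
def velocity (γ : ℝ → M) (t : ℝ) : TangentSpace 𝓘(ℝ, E) (γ t) :=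
  mfderivWithin 𝓘(ℝ, ℝ) 𝓘(ℝ, E) γ (Icc 0 1) t (1 : ℝ)

variable (E) in
/-- `γ` is a geodesic segment from `x` to `y`, parametrized by `[0, 1]`: a smooth curve of constant
speed that realizes the distance between any two of its points. (On a Hadamard manifold every
geodesic is distance minimizing, and there is exactly one geodesic between two given points.)
For such a curve, `velocity γ 0` is the vector `exp_x⁻¹(y)`. -/
structure IsGeodesic (γ : ℝ → M) (x y : M) : Prop where
  smooth : ContMDiffOn 𝓘(ℝ, ℝ) 𝓘(ℝ, E) ∞ γ (Icc 0 1)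
  source : γ 0 = x
  target : γ 1 = y
  speed : ∀ t ∈ Icc (0 : ℝ) 1, ‖velocity (E := E) γ t‖ = dist x y
  dist_eq : ∀ s ∈ Icc (0 : ℝ) 1, ∀ t ∈ Icc (0 : ℝ) 1, dist (γ s) (γ t) = |s - t| * dist x y

variable (E) in
/-- A set is geodesically convex if any two of its points are joined by a geodesic that remains in
the set. -/
def GConvex (X : Set M) : Prop :=
  ∀ x ∈ X, ∀ y ∈ X, ∃ γ : ℝ → M, IsGeodesic E γ x y ∧ ∀ t ∈ Icc (0 : ℝ) 1, γ t ∈ X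

variable (E) in
/-- The Riemannian gradient `∇ f (x) ∈ T_x M`, the Riesz representative of the differential of `f`
at `x`. -/
def riemGradient (f : M → ℝ) (x : M) : TangentSpace 𝓘(ℝ, E) x :=
  haveI : FiniteDimensional ℝ (TangentSpace 𝓘(ℝ, E) x) := inferInstanceAs (FiniteDimensional ℝ E)
  haveI : CompleteSpace (TangentSpace 𝓘(ℝ, E) x) := FiniteDimensional.complete ℝ _
  (InnerProductSpace.toDual ℝ (TangentSpace 𝓘(ℝ, E) x)).symm (mvfderiv 𝓘(ℝ, E) f x)

variable (E) in
/-- `μ`-strong geodesic convexity of a differentiable function on a set: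
`f y ≥ f x + ⟨∇ f x, exp_x⁻¹ y⟩ + (μ / 2) d(x, y)²`. -/
def StronglyGConvexOn (μ : ℝ) (X : Set M) (f : M → ℝ) : Prop :=
  ∀ x ∈ X, ∀ y ∈ X, ∀ γ : ℝ → M, IsGeodesic E γ x y →
    f (γ 0) + inner ℝ (riemGradient E f (γ 0)) (velocity γ 0) + μ / 2 * dist x y ^ 2 ≤ f y

variable [IsContMDiffRiemannianBundle 𝓘(ℝ, E) ∞ E (fun x : M ↦ TangentSpace 𝓘(ℝ, E) x)]

/-- `cov` is the Levi-Civita connection: it is compatible with the metric and torsion free. -/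
def IsLeviCivita
    (cov : CovariantDerivative 𝓘(ℝ, E) E (fun x : M ↦ TangentSpace 𝓘(ℝ, E) x)) : Prop :=
  (∀ (x : M) (v : TangentSpace 𝓘(ℝ, E) x) (V W : Π x : M, TangentSpace 𝓘(ℝ, E) x),
    MDifferentiableAt 𝓘(ℝ, E) 𝓘(ℝ, E).tangent
      (fun p ↦ (⟨p, V p⟩ : TangentBundle 𝓘(ℝ, E) M)) x →
    MDifferentiableAt 𝓘(ℝ, E) 𝓘(ℝ, E).tangent
      (fun p ↦ (⟨p, W p⟩ : TangentBundle 𝓘(ℝ, E) M)) x →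
    mvfderiv 𝓘(ℝ, E) (fun p ↦ inner ℝ (V p) (W p)) x v
      = inner ℝ (cov V x v) (W x) + inner ℝ (V x) (cov W x v)) ∧
  cov.torsion = 0

/-- The curvature `R(V, W) Z = ∇_V ∇_W Z - ∇_W ∇_V Z - ∇_[V, W] Z`. -/
def curvature (cov : CovariantDerivative 𝓘(ℝ, E) E (fun x : M ↦ TangentSpace 𝓘(ℝ, E) x))
    (V W Z : Π x : M, TangentSpace 𝓘(ℝ, E) x) (x : M) : TangentSpace 𝓘(ℝ, E) x :=
  cov (fun p ↦ cov Z p (W p)) x (V x) - cov (fun p ↦ cov Z p (V p)) x (W x)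
    - cov Z x (VectorField.mlieBracket 𝓘(ℝ, E) V W x)

/-- The sectional curvature at `x` of the plane spanned by `V x` and `W x` (and `0` where these two
vectors are linearly dependent). -/
def sectionalCurvature
    (cov : CovariantDerivative 𝓘(ℝ, E) E (fun x : M ↦ TangentSpace 𝓘(ℝ, E) x))
    (V W : Π x : M, TangentSpace 𝓘(ℝ, E) x) (x : M) : ℝ :=
  inner ℝ (curvature cov V W W x) (V x) / (‖V x‖ ^ 2 * ‖W x‖ ^ 2 - inner ℝ (V x) (W x) ^ 2)

variable (E M) in
/-- A Hadamard manifold is a complete simply connected Riemannian manifold of non-positive sectional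
curvature. The Riemannian structure itself is carried by the type classes. -/
structure IsHadamard : Prop where
  riemannian : IsRiemannianManifold 𝓘(ℝ, E) M
  complete : CompleteSpace M
  simplyConnected : SimplyConnectedSpace M
  nonpositive : ∃ cov : CovariantDerivative 𝓘(ℝ, E) E (fun x : M ↦ TangentSpace 𝓘(ℝ, E) x),
    IsLeviCivita cov ∧ ∀ V W : Π x : M, TangentSpace 𝓘(ℝ, E) x,
      ContMDiff 𝓘(ℝ, E) 𝓘(ℝ, E).tangent ∞ (fun x ↦ (⟨x, V x⟩ : TangentBundle 𝓘(ℝ, E) M)) →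
      ContMDiff 𝓘(ℝ, E) 𝓘(ℝ, E).tangent ∞ (fun x ↦ (⟨x, W x⟩ : TangentBundle 𝓘(ℝ, E) M)) →
      ∀ x, sectionalCurvature cov V W x ≤ 0

/-- The vector field `V` along `γ` is parallel for the Levi-Civita connection `∇`. Around `γ t` write
`V s = ∑ i, c i s • e i (γ s)` in the coordinate frame `e` of the chart at `γ t`; the condition is
`∑ i, c' i t • e i (γ t) + ∇_{γ' t} (∑ i, c i t • e i) = 0`. -/
def IsParallelAlong (γ : ℝ → M) (V : Π t : ℝ, TangentSpace 𝓘(ℝ, E) (γ t)) : Prop :=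
  ∃ cov : CovariantDerivative 𝓘(ℝ, E) E (fun x : M ↦ TangentSpace 𝓘(ℝ, E) x),
    IsLeviCivita cov ∧ ∀ t ∈ Icc (0 : ℝ) 1,
      let φ := trivializationAt E (fun x : M ↦ TangentSpace 𝓘(ℝ, E) x) (γ t)
      HasDerivWithinAt (fun s ↦ φ.continuousLinearMapAt ℝ (γ s) (V s))
        (-φ.continuousLinearMapAt ℝ (γ t)
          (cov (fun p ↦ φ.symmL ℝ p (φ.continuousLinearMapAt ℝ (γ t) (V t))) (γ t)
            (velocity γ t)))
        (Icc 0 1) t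

variable (E) in
/-- `‖∇ f x - Γ (∇ f y)‖ ≤ L d(x, y)` for `x, y ∈ X`, where `Γ` is the parallel transport along the
geodesic from `y` to `x`. -/
def HasLipschitzGradientOn (L : ℝ≥0) (X : Set M) (f : M → ℝ) : Prop :=
  ∀ x ∈ X, ∀ y ∈ X, ∀ γ : ℝ → M, IsGeodesic E γ y x →
    ∀ V : Π t : ℝ, TangentSpace 𝓘(ℝ, E) (γ t), IsParallelAlong γ V →
      V 0 = riemGradient E f (γ 0) → ‖riemGradient E f (γ 1) - V 1‖ ≤ L * dist x y

end OneManifold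

section TwoManifolds

variable (E : Type*) [NormedAddCommGroup E] [NormedSpace ℝ E] [FiniteDimensional ℝ E]
  {M : Type*} [MetricSpace M] [ChartedSpace E M] [IsManifold 𝓘(ℝ, E) ∞ M]
  [RiemannianBundle (fun x : M ↦ TangentSpace 𝓘(ℝ, E) x)]
  [IsContMDiffRiemannianBundle 𝓘(ℝ, E) ∞ E (fun x : M ↦ TangentSpace 𝓘(ℝ, E) x)]
  (F : Type*) [NormedAddCommGroup F] [NormedSpace ℝ F] [FiniteDimensional ℝ F]
  {N : Type*} [MetricSpace N] [ChartedSpace F N] [IsManifold 𝓘(ℝ, F) ∞ N]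
  [RiemannianBundle (fun y : N ↦ TangentSpace 𝓘(ℝ, F) y)]
  [IsContMDiffRiemannianBundle 𝓘(ℝ, F) ∞ F (fun y : N ↦ TangentSpace 𝓘(ℝ, F) y)]

/-- `g` is differentiable, and on `X × Y` it is `(μx, μy)`-strongly g-convex strongly g-concave and
`(Lx, Ly, Lxy)`-smooth. The partial gradients `∇_x g(x, ·)` (resp. `∇_y g(·, y)`) at different
arguments lie in one and the same tangent space `T_x M` (resp. `T_y N`). -/
structure IsSmoothSCSC (μx μy : ℝ) (Lx Ly Lxy : ℝ≥0) (X : Set M) (Y : Set N) (g : M → N → ℝ) :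
    Prop where
  differentiable : MDifferentiable (𝓘(ℝ, E).prod 𝓘(ℝ, F)) 𝓘(ℝ, ℝ) (fun p : M × N ↦ g p.1 p.2)
  stronglyConvex : ∀ y ∈ Y, StronglyGConvexOn E μx X (fun x ↦ g x y)
  stronglyConcave : ∀ x ∈ X, StronglyGConvexOn F μy Y (fun y ↦ -g x y)
  lipschitz_x : ∀ y ∈ Y, HasLipschitzGradientOn E Lx X (fun x ↦ g x y)
  lipschitz_y : ∀ x ∈ X, HasLipschitzGradientOn F Ly Y (fun y ↦ g x y)
  lipschitz_yx : ∀ y ∈ Y, ∀ x ∈ X, ∀ x' ∈ X,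
    ‖riemGradient F (fun z ↦ g x z) y - riemGradient F (fun z ↦ g x' z) y‖ ≤ Lxy * dist x x'
  lipschitz_xy : ∀ x ∈ X, ∀ y ∈ Y, ∀ y' ∈ Y,
    ‖riemGradient E (fun z ↦ g z y) x - riemGradient E (fun z ↦ g z y') x‖ ≤ Lxy * dist y y'

end TwoManifolds

section Gaps

variable {M N : Type*}

/-- The duality gap `max_{y ∈ Y} g(x, y) - min_{x ∈ X} g(x, y)` at the pair `(a, b)`. -/
def gap (g : M → N → ℝ) (X : Set M) (Y : Set N) (a : M) (b : N) : ℝ :=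
  sSup ((fun y ↦ g a y) '' Y) - sInf ((fun x ↦ g x b) '' X)

/-- The gap in the first variable, `max_{y ∈ Y} g(a, y) - g(xs, ys)`. -/
def gapX (g : M → N → ℝ) (Y : Set N) (xs : M) (ys : N) (a : M) : ℝ :=
  sSup ((fun y ↦ g a y) '' Y) - g xs ys

/-- The gap in the second variable, `g(xs, ys) - min_{x ∈ X} g(x, b)`. -/
def gapY (g : M → N → ℝ) (X : Set M) (xs : M) (ys : N) (b : N) : ℝ :=
  g xs ys - sInf ((fun x ↦ g x b) '' X)

/-- `a` is an `ε`-minimizer of `f` over `X`. -/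
def IsApproxMinOn (ε : ℝ) (f : M → ℝ) (X : Set M) (a : M) : Prop :=
  a ∈ X ∧ f a ≤ sInf (f '' X) + ε

end Gaps

end

end RiemannianMinMax

open RiemannianMinMax

/-! Strong g-convexity becomes one-dimensional strong convexity along geodesics, which gives
quadratic growth at minimizers: `f x + μ / 2 * d² ≤ f z`. Applied to two functions whose gradients
differ by at most `C`, growth at both minimizers bounds their distance by `C / μ`
(`StronglyGConvexOn.mul_dist_le`). Hence the best responses `x*(y)` and `y*(x)` are Lipschitz with
constants `Lxy / μx` and `Lxy / μy`.

`IsMetricStronglyConvex` collects these facts in purely metric terms; it holds for `g` and, with the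
variables exchanged, for `-g`. A saddle point comes from minimizing the primal function `x ↦ g x
(y*(x))`, without a minimax theorem or compactness: strong convexity makes minimizing sequences
Cauchy (`IsMetricStronglyConvex.exists_isSaddlePointOn`). The four gap estimates then combine
quadratic growth, Lipschitz best responses and the triangle inequality. -/

namespace RiemannianMinMax

open Filter Topology

/-! ### Strongly convex minimization in metric spaces. -/

section Metric

variable {M : Type*} [MetricSpace M]

/-- A continuous, bounded below function on a complete set which satisfies the midpoint form of
strong convexity attains its minimum. -/
theorem exists_isMinOn_of_midpoint_strongly_convex {X : Set M} (hX : IsComplete X)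
    (hne : X.Nonempty) {f : M → ℝ} (hf : ContinuousOn f X) (hbd : BddBelow (f '' X)) {μ : ℝ}
    (hμ : 0 < μ)
    (hmid : ∀ x ∈ X, ∀ x' ∈ X, ∃ m ∈ X, f m + μ / 8 * dist x x' ^ 2 ≤ (f x + f x') / 2) :
    ∃ x ∈ X, IsMinOn f X x := by
  set I := sInf (f '' X) with hI
  have hle : ∀ x ∈ X, I ≤ f x := fun x hx ↦ csInf_le hbd (mem_image_of_mem f hx)
  have hex : ∀ n : ℕ, ∃ x ∈ X, f x < I + 1 / ((n : ℝ) + 1) := by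
    intro n
    obtain ⟨_, ⟨x, hx, rfl⟩, h⟩ := Real.lt_sInf_add_pos (hne.image f)
      (ε := 1 / ((n : ℝ) + 1)) (by positivity)
    exact ⟨x, hx, h⟩
  choose u huX hu using hex
  have hlim : Tendsto (fun n : ℕ ↦ 1 / ((n : ℝ) + 1)) atTop (𝓝 0) :=
    tendsto_one_div_add_atTop_nhds_zero_nat
  have hcau : CauchySeq u := by
    refine cauchySeq_of_le_tendsto_0 (fun n : ℕ ↦ √(8 / μ * (1 / ((n : ℝ) + 1)))) ?_ ?_
    · intro n k N hn hk
      apply Real.le_sqrt_of_sq_le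
      obtain ⟨m, hm, h⟩ := hmid _ (huX n) _ (huX k)
      have h1 : 1 / ((n : ℝ) + 1) ≤ 1 / ((N : ℝ) + 1) := by gcongr
      have h2 : 1 / ((k : ℝ) + 1) ≤ 1 / ((N : ℝ) + 1) := by gcongr
      -- The midpoint value is at least the infimum, so the strong convexity term is at most the
      -- average excess of `u n` and `u k`.
      have h3 : μ / 8 * dist (u n) (u k) ^ 2 ≤ 1 / ((N : ℝ) + 1) := by
        linarith [hle m hm, hu n, hu k]
      calc dist (u n) (u k) ^ 2 = 8 / μ * (μ / 8 * dist (u n) (u k) ^ 2) := by field_simp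
        _ ≤ _ := by gcongr
    · simpa using (hlim.const_mul (8 / μ)).sqrt
  obtain ⟨x, hx, hux⟩ := cauchySeq_tendsto_of_isComplete hX huX hcau
  refine ⟨x, hx, fun z hz ↦ le_trans ?_ (hle z hz)⟩
  have hfx : Tendsto (fun n ↦ f (u n)) atTop (𝓝 (f x)) :=
    (hf x hx).tendsto.comp (tendsto_nhdsWithin_iff.2 ⟨hux, Eventually.of_forall huX⟩)
  refine le_of_tendsto_of_tendsto' hfx (by simpa using hlim.const_add I) fun n ↦ (hu n).le

/-- A minimizer of a function that is strongly convex along segments has quadratic growth. -/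
theorem quadratic_growth_of_isMinOn {X : Set M} {f : M → ℝ} {μ : ℝ} {x z : M} {γ : ℝ → M}
    (hmin : IsMinOn f X x) (hγX : ∀ t ∈ Icc (0 : ℝ) 1, γ t ∈ X)
    (hγ : ∀ t ∈ Icc (0 : ℝ) 1,
      f (γ t) + μ / 2 * (t * (1 - t)) * dist x z ^ 2 ≤ (1 - t) * f x + t * f z) :
    f x + μ / 2 * dist x z ^ 2 ≤ f z := by
  -- Minimality gives `f x ≤ f (γ t)`; cancel `(1 - t) * f x`, divide by `t`, then let `t → 0`.
  have hev : ∀ᶠ t in 𝓝[>] (0 : ℝ), f x + μ / 2 * (1 - t) * dist x z ^ 2 ≤ f z := by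
    filter_upwards [Ioc_mem_nhdsGT (zero_lt_one' ℝ)] with t ht
    have h1 : f x ≤ f (γ t) := hmin (hγX t ⟨ht.1.le, ht.2⟩)
    have h2 := hγ t ⟨ht.1.le, ht.2⟩
    refine le_of_mul_le_mul_left ?_ ht.1
    linarith
  have hlim : Tendsto (fun t : ℝ ↦ f x + μ / 2 * (1 - t) * dist x z ^ 2) (𝓝[>] 0)
      (𝓝 (f x + μ / 2 * (1 - 0) * dist x z ^ 2)) :=
    tendsto_nhdsWithin_of_tendsto_nhds (Continuous.tendsto (by fun_prop) 0)
  simpa using le_of_tendsto hlim hev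

end Metric

/-! ### Calculus and strong convexity along geodesics. -/

section OneManifold

variable {E : Type*} [NormedAddCommGroup E] [NormedSpace ℝ E]
  {M : Type*} [MetricSpace M] [ChartedSpace E M]
  [RiemannianBundle (fun x : M ↦ TangentSpace 𝓘(ℝ, E) x)]

theorem add_mul_sub_mem_Icc {a b t : ℝ} (ha : a ∈ Icc (0 : ℝ) 1) (hb : b ∈ Icc (0 : ℝ) 1)
    (ht : t ∈ Icc (0 : ℝ) 1) : a + t * (b - a) ∈ Icc (0 : ℝ) 1 :=
  (convex_Icc (0 : ℝ) 1).add_smul_sub_mem ha hb ht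

theorem IsGeodesic.mdifferentiableWithinAt {γ : ℝ → M} {x y : M} (hγ : IsGeodesic E γ x y) {t : ℝ}
    (ht : t ∈ Icc (0 : ℝ) 1) :
    MDifferentiableWithinAt 𝓘(ℝ, ℝ) 𝓘(ℝ, E) γ (Icc 0 1) t :=
  (hγ.smooth t ht).mdifferentiableWithinAt (by simp)

theorem IsGeodesic.velocity_reparam {γ : ℝ → M} {x y : M} (hγ : IsGeodesic E γ x y) {a b t : ℝ}
    (ha : a ∈ Icc (0 : ℝ) 1) (hb : b ∈ Icc (0 : ℝ) 1) (ht : t ∈ Icc (0 : ℝ) 1) :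
    velocity (E := E) (fun s ↦ γ (a + s * (b - a))) t
      = (b - a) • velocity (E := E) γ (a + t * (b - a)) := by
  have h1 : HasMFDerivWithinAt 𝓘(ℝ, ℝ) 𝓘(ℝ, ℝ) (fun s : ℝ ↦ a + s * (b - a)) (Icc 0 1) t
      (ContinuousLinearMap.toSpanSingleton ℝ (b - a)) := by
    have := (((hasDerivAt_id t).mul_const (b - a)).const_add a).hasDerivWithinAt
      (s := Icc (0 : ℝ) 1)
    rw [one_mul] at this
    exact this.hasFDerivWithinAt.hasMFDerivWithinAt
  have h2 := (hγ.mdifferentiableWithinAt (add_mul_sub_mem_Icc ha hb ht)).hasMFDerivWithinAt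
  have hmaps : Icc (0 : ℝ) 1 ⊆ (fun s ↦ a + s * (b - a)) ⁻¹' Icc 0 1 :=
    fun s hs ↦ add_mul_sub_mem_Icc ha hb hs
  have h3 := (h2.comp t h1 hmaps).mfderivWithin
    ((uniqueDiffOn_Icc (zero_lt_one' ℝ)) t ht).uniqueMDiffWithinAt
  refine (DFunLike.congr_fun h3 (1 : ℝ)).trans ?_
  let A : ℝ →L[ℝ] E := mfderivWithin 𝓘(ℝ, ℝ) 𝓘(ℝ, E) γ (Icc 0 1) (a + t * (b - a))
  change A ((1 : ℝ) • (b - a)) = (b - a) • A (1 : ℝ)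
  rw [← A.map_smul]
  simp

/-- The restriction of a geodesic to the parameters between `a` and `b` (in this order) is a
geodesic. -/
theorem IsGeodesic.reparam {γ : ℝ → M} {x y : M} (hγ : IsGeodesic E γ x y) {a b : ℝ}
    (ha : a ∈ Icc (0 : ℝ) 1) (hb : b ∈ Icc (0 : ℝ) 1) :
    IsGeodesic E (fun s ↦ γ (a + s * (b - a))) (γ a) (γ b) where
  smooth := by
    refine hγ.smooth.comp (ContDiff.contMDiff ?_).contMDiffOn
      (fun s hs ↦ add_mul_sub_mem_Icc ha hb hs)
    fun_prop
  source := by simp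
  target := by simp
  speed t ht := by
    rw [hγ.velocity_reparam ha hb ht, norm_smul,
      hγ.speed _ (add_mul_sub_mem_Icc ha hb ht), hγ.dist_eq a ha b hb, Real.norm_eq_abs,
      abs_sub_comm]
  dist_eq s hs t ht := by
    rw [hγ.dist_eq _ (add_mul_sub_mem_Icc ha hb hs) _ (add_mul_sub_mem_Icc ha hb ht),
      hγ.dist_eq a ha b hb, ← mul_assoc, abs_sub_comm a b, ← abs_mul]
    ring_nf

variable [FiniteDimensional ℝ E]

theorem inner_riemGradient (f : M → ℝ) (x : M) (v : TangentSpace 𝓘(ℝ, E) x) :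
    inner ℝ (riemGradient E f x) v = mvfderiv 𝓘(ℝ, E) f x v := by
  have : FiniteDimensional ℝ (TangentSpace 𝓘(ℝ, E) x) := inferInstanceAs (FiniteDimensional ℝ E)
  have : CompleteSpace (TangentSpace 𝓘(ℝ, E) x) := FiniteDimensional.complete ℝ _
  exact InnerProductSpace.toDual_symm_apply

theorem riemGradient_neg (f : M → ℝ) (x : M) :
    riemGradient E (fun z ↦ -f z) x = -riemGradient E f x := by
  refine ext_inner_right ℝ fun v ↦ ?_
  rw [inner_neg_left, inner_riemGradient, inner_riemGradient]
  exact DFunLike.congr_fun (mvfderiv_neg (g := f)) v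

/-- The chain rule along a geodesic. -/
theorem IsGeodesic.hasDerivWithinAt_comp {γ : ℝ → M} {x y : M} (hγ : IsGeodesic E γ x y) {t : ℝ}
    (ht : t ∈ Icc (0 : ℝ) 1) {f : M → ℝ} (hf : MDifferentiable 𝓘(ℝ, E) 𝓘(ℝ, ℝ) f) :
    HasDerivWithinAt (fun s ↦ f (γ s)) (inner ℝ (riemGradient E f (γ t)) (velocity γ t))
      (Icc 0 1) t := by
  rw [inner_riemGradient]
  have h := (hf (γ t)).hasMFDerivAt.comp_hasMFDerivWithinAt t
    (hγ.mdifferentiableWithinAt ht).hasMFDerivWithinAt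
  have h' : HasFDerivWithinAt (𝕜 := ℝ) (E := ℝ) (F := ℝ) (fun s ↦ f (γ s)) _ (Icc 0 1) t :=
    h.hasFDerivWithinAt
  exact h'.hasDerivWithinAt

/-- A strongly g-convex function is strongly convex along each geodesic. -/
theorem StronglyGConvexOn.le_of_isGeodesic {μ : ℝ} {X : Set M} {f : M → ℝ}
    (hf : StronglyGConvexOn E μ X f) {γ : ℝ → M} {x y : M} (hγ : IsGeodesic E γ x y)
    (hγX : ∀ t ∈ Icc (0 : ℝ) 1, γ t ∈ X) {t : ℝ} (ht : t ∈ Icc (0 : ℝ) 1) :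
    f (γ t) + μ / 2 * (t * (1 - t)) * dist x y ^ 2 ≤ (1 - t) * f x + t * f y := by
  -- The defining inequality is based at `γ t` and taken towards `γ b`. Weighting `b = 0` by `1 - t`
  -- and `b = 1` by `t` cancels the gradient terms, and the quadratic terms add up to `t * (1 - t)`.
  have key : ∀ b ∈ Icc (0 : ℝ) 1,
      f (γ t) + (b - t) * inner ℝ (riemGradient E f (γ t)) (velocity γ t)
        + μ / 2 * ((t - b) ^ 2 * dist x y ^ 2) ≤ f (γ b) := by
    intro b hb
    have h := hf _ (hγX t ht) _ (hγX b hb) _ (hγ.reparam ht hb)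
    rw [hγ.velocity_reparam ht hb ⟨le_rfl, zero_le_one⟩, hγ.dist_eq t ht b hb, mul_pow, sq_abs,
      inner_smul_right] at h
    have h0 : t + 0 * (b - t) = t := by ring
    rw [h0] at h
    exact h
  have h0 := key 0 ⟨le_rfl, zero_le_one⟩
  have h1 := key 1 ⟨zero_le_one, le_rfl⟩
  rw [hγ.source] at h0
  rw [hγ.target] at h1
  have h0' := mul_le_mul_of_nonneg_left h0 (sub_nonneg.2 ht.2)
  have h1' := mul_le_mul_of_nonneg_left h1 ht.1
  linarith

theorem StronglyGConvexOn.bddBelow {μ : ℝ} (hμ : 0 < μ) {X : Set M} (hX : GConvex E X) {f : M → ℝ}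
    (hf : StronglyGConvexOn E μ X f) : BddBelow (f '' X) := by
  rcases X.eq_empty_or_nonempty with rfl | ⟨x, hx⟩
  · simp
  -- The minimum over `r` of `f x - ‖∇f x‖ * r + μ / 2 * r ^ 2`.
  refine ⟨f x - ‖riemGradient E f x‖ ^ 2 / (2 * μ), ?_⟩
  rintro _ ⟨y, hy, rfl⟩
  obtain ⟨γ, hγ, -⟩ := hX x hx y hy
  have h := hf x hx y hy γ hγ
  have hin := (abs_le.1 (abs_real_inner_le_norm (riemGradient E f (γ 0)) (velocity γ 0))).1
  rw [hγ.speed 0 ⟨le_rfl, zero_le_one⟩, hγ.source] at hin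
  have h' : f x - ‖riemGradient E f x‖ * dist x y + μ / 2 * dist x y ^ 2 ≤ f y := by
    rw [hγ.source] at h
    linarith
  refine le_trans ?_ h'
  have : 0 ≤ (‖riemGradient E f x‖ - μ * dist x y) ^ 2 / (2 * μ) := by positivity
  have e : (‖riemGradient E f x‖ - μ * dist x y) ^ 2 / (2 * μ) = ‖riemGradient E f x‖ ^ 2 / (2 * μ)
      - ‖riemGradient E f x‖ * dist x y + μ / 2 * dist x y ^ 2 := by
    field_simp
    ring
  linarith

/-- The difference of two functions is Lipschitz along a geodesic on which their gradients are
uniformly close. -/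
theorem IsGeodesic.abs_sub_sub_le {γ : ℝ → M} {x y : M} (hγ : IsGeodesic E γ x y) {f h : M → ℝ}
    (hf : MDifferentiable 𝓘(ℝ, E) 𝓘(ℝ, ℝ) f) (hh : MDifferentiable 𝓘(ℝ, E) 𝓘(ℝ, ℝ) h) {C : ℝ}
    (hC : ∀ t ∈ Icc (0 : ℝ) 1, ‖riemGradient E f (γ t) - riemGradient E h (γ t)‖ ≤ C) :
    |(f y - h y) - (f x - h x)| ≤ C * dist x y := by
  have hb : ∀ t ∈ Icc (0 : ℝ) 1, ‖inner ℝ (riemGradient E f (γ t)) (velocity γ t)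
      - inner ℝ (riemGradient E h (γ t)) (velocity γ t)‖ ≤ C * dist x y := by
    intro t ht
    rw [← inner_sub_left, ← hγ.speed t ht]
    exact (norm_inner_le_norm _ _).trans (mul_le_mul_of_nonneg_right (hC t ht) (norm_nonneg _))
  have := (convex_Icc (0 : ℝ) 1).norm_image_sub_le_of_norm_hasDerivWithin_le
    (fun t ht ↦ (hγ.hasDerivWithinAt_comp ht hf).sub (hγ.hasDerivWithinAt_comp ht hh)) hb
    (left_mem_Icc.2 zero_le_one) (right_mem_Icc.2 zero_le_one)
  simpa [hγ.source, hγ.target] using this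

end OneManifold

/-! ### Best responses and existence of a saddle point. -/

section MinMax

variable {M N : Type*} [MetricSpace M] [MetricSpace N]

/-- The metric content of strong convexity in the first variable: two points of `X` are joined
inside `X` by a segment along which all functions `g · y` are `μ`-strongly convex, these functions
are bounded below, and their minimizers are `L / μ`-Lipschitz in `y`. -/
structure IsMetricStronglyConvex (μ L : ℝ) (X : Set M) (Y : Set N) (g : M → N → ℝ) : Prop where
  segment : ∀ x ∈ X, ∀ x' ∈ X, ∃ γ : ℝ → M, ∀ t ∈ Icc (0 : ℝ) 1, γ t ∈ X ∧
    dist (γ t) x = t * dist x x' ∧ ∀ y ∈ Y,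
      g (γ t) y + μ / 2 * (t * (1 - t)) * dist x x' ^ 2 ≤ (1 - t) * g x y + t * g x' y
  bddBelow : ∀ y ∈ Y, BddBelow ((fun x ↦ g x y) '' X)
  dist_le : ∀ y ∈ Y, ∀ y' ∈ Y, ∀ x ∈ X, ∀ x' ∈ X, IsMinOn (fun z ↦ g z y) X x →
    IsMinOn (fun z ↦ g z y') X x' → μ * dist x x' ≤ L * dist y y'

variable {X : Set M} {Y : Set N} {g : M → N → ℝ} {μ L : ℝ}

namespace IsMetricStronglyConvex

theorem exists_midpoint (h : IsMetricStronglyConvex μ L X Y g) {x x' : M} (hx : x ∈ X)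
    (hx' : x' ∈ X) :
    ∃ m ∈ X, ∀ y ∈ Y, g m y + μ / 8 * dist x x' ^ 2 ≤ (g x y + g x' y) / 2 := by
  obtain ⟨γ, hγ⟩ := h.segment x hx x' hx'
  obtain ⟨hm, -, hc⟩ := hγ (1 / 2) ⟨by norm_num, by norm_num⟩
  exact ⟨_, hm, fun y hy ↦ by linarith [hc y hy]⟩

theorem exists_isMinOn (h : IsMetricStronglyConvex μ L X Y g) (hμ : 0 < μ) (hX : IsComplete X)
    (hne : X.Nonempty) {y : N} (hy : y ∈ Y) (hg : ContinuousOn (fun x ↦ g x y) X) :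
    ∃ x ∈ X, IsMinOn (fun z ↦ g z y) X x := by
  refine exists_isMinOn_of_midpoint_strongly_convex hX hne hg (h.bddBelow y hy) hμ ?_
  intro x hx x' hx'
  obtain ⟨m, hm, hc⟩ := h.exists_midpoint hx hx'
  exact ⟨m, hm, hc y hy⟩

theorem quadratic_growth (h : IsMetricStronglyConvex μ L X Y g) {y : N} (hy : y ∈ Y) {x z : M}
    (hx : x ∈ X) (hz : z ∈ X) (hmin : IsMinOn (fun w ↦ g w y) X x) :
    g x y + μ / 2 * dist z x ^ 2 ≤ g z y := by
  obtain ⟨γ, hγ⟩ := h.segment x hx z hz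
  rw [dist_comm]
  exact quadratic_growth_of_isMinOn (f := fun w ↦ g w y) hmin (fun t ht ↦ (hγ t ht).1)
    fun t ht ↦ (hγ t ht).2.2 y hy

theorem existsUnique_isMinOn (h : IsMetricStronglyConvex μ L X Y g) (hμ : 0 < μ)
    (hX : IsComplete X) (hne : X.Nonempty) {y : N} (hy : y ∈ Y)
    (hg : ContinuousOn (fun x ↦ g x y) X) :
    ∃! x, x ∈ X ∧ IsMinOn (fun z ↦ g z y) X x := by
  obtain ⟨x, hx, hmin⟩ := h.exists_isMinOn hμ hX hne hy hg
  refine ⟨x, ⟨hx, hmin⟩, fun z ⟨hz, hzmin⟩ ↦ dist_le_zero.1 ?_⟩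
  -- Uniqueness is Lipschitz dependence on the parameter, at equal parameters.
  have := h.dist_le y hy y hy z hz x hx hzmin hmin
  rw [dist_self, mul_zero] at this
  exact le_of_mul_le_mul_left (this.trans_eq (mul_zero μ).symm) hμ

/-- A function which is strongly convex in the first and strongly concave in the second variable
has a saddle point. -/
theorem exists_isSaddlePointOn {μ' L' : ℝ} (hgX : IsMetricStronglyConvex μ L X Y g)
    (hgY : IsMetricStronglyConvex μ' L' Y X (fun y x ↦ -g x y)) (hμ : 0 < μ) (hμ' : 0 < μ')
    (hg : Continuous (fun p : M × N ↦ g p.1 p.2)) (hX : IsComplete X) (hY : IsComplete Y)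
    (hXne : X.Nonempty) (hYne : Y.Nonempty) :
    ∃ x ∈ X, ∃ y ∈ Y, IsSaddlePointOn X Y g x y := by
  have hex : ∀ x : M, ∃ y, x ∈ X → y ∈ Y ∧ ∀ z ∈ Y, g x z ≤ g x y := by
    intro x
    by_cases hx : x ∈ X
    · obtain ⟨y, hy, hmin⟩ := hgY.exists_isMinOn hμ' hY hYne hx
        (Continuous.continuousOn (by fun_prop))
      exact ⟨y, fun _ ↦ ⟨hy, fun z hz ↦ neg_le_neg_iff.1 (hmin hz)⟩⟩
    · exact ⟨hYne.some, fun h ↦ absurd h hx⟩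
  choose Φ hΦ using hex
  have hΦY : ∀ x ∈ X, Φ x ∈ Y := fun x hx ↦ (hΦ x hx).1
  have hΦmax : ∀ x ∈ X, ∀ y ∈ Y, g x y ≤ g x (Φ x) := fun x hx ↦ (hΦ x hx).2
  have hΦmin : ∀ x ∈ X, IsMinOn (fun y ↦ -g x y) Y (Φ x) :=
    fun x hx y hy ↦ neg_le_neg (hΦmax x hx y hy)
  have hΦdist : ∀ x ∈ X, ∀ x' ∈ X, dist (Φ x) (Φ x') ≤ L' / μ' * dist x x' := by
    intro x hx x' hx'
    rw [div_mul_eq_mul_div, le_div_iff₀' hμ']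
    exact hgY.dist_le x hx x' hx' _ (hΦY x hx) _ (hΦY x' hx') (hΦmin x hx) (hΦmin x' hx')
  have hΦc : ContinuousOn Φ X := by
    refine (LipschitzOnWith.of_dist_le_mul (K := (L' / μ').toNNReal)
      fun x hx x' hx' ↦ ?_).continuousOn
    exact (hΦdist x hx x' hx').trans
      (mul_le_mul_of_nonneg_right (Real.le_coe_toNNReal _) dist_nonneg)
  -- The primal function `x ↦ max_y g x y` inherits midpoint strong convexity: the midpoint `m`
  -- serves every `y` at once, in particular `y = Φ m`.
  obtain ⟨x, hx, hmin⟩ : ∃ x ∈ X, IsMinOn (fun x ↦ g x (Φ x)) X x := by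
    refine exists_isMinOn_of_midpoint_strongly_convex hX hXne
      (hg.comp_continuousOn (continuousOn_id.prodMk hΦc)) ?_ hμ ?_
    · obtain ⟨y, hy⟩ := hYne
      obtain ⟨B, hB⟩ := hgX.bddBelow y hy
      refine ⟨B, ?_⟩
      rintro _ ⟨x, hx, rfl⟩
      exact (hB (mem_image_of_mem _ hx)).trans (hΦmax x hx y hy)
    · intro x hx x' hx'
      obtain ⟨m, hm, hc⟩ := hgX.exists_midpoint hx hx'
      refine ⟨m, hm, ?_⟩
      linarith [hc _ (hΦY m hm), hΦmax x hx _ (hΦY m hm), hΦmax x' hx' _ (hΦY m hm)]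
  -- It remains to see `g x (Φ x) ≤ g z (Φ x)`. On the segment from `x` to `z`, with `y = Φ (γ t)`,
  -- minimality and convexity give `g x (Φ x) ≤ (1 - t) * g x y + t * g z y ≤ (1 - t) * g x (Φ x) +
  -- t * g z y`. Hence `g x (Φ x) ≤ g z (Φ (γ t))`, and `Φ (γ t) → Φ x` as `t → 0`.
  refine ⟨x, hx, Φ x, hΦY x hx, fun z hz y hy ↦ (hΦmax x hx y hy).trans ?_⟩
  obtain ⟨γ, hγ⟩ := hgX.segment x hx z hz
  have hγx : Tendsto γ (𝓝[>] 0) (𝓝[X] x) := by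
    have hmem : ∀ᶠ t in 𝓝[>] (0 : ℝ), t ∈ Icc (0 : ℝ) 1 := by
      filter_upwards [Ioc_mem_nhdsGT (zero_lt_one' ℝ)] with t ht using ⟨ht.1.le, ht.2⟩
    refine tendsto_nhdsWithin_iff.2 ⟨tendsto_iff_dist_tendsto_zero.2 ?_,
      hmem.mono fun t ht ↦ (hγ t ht).1⟩
    have hlim : Tendsto (fun t : ℝ ↦ t * dist x z) (𝓝[>] 0) (𝓝 (0 * dist x z)) :=
      tendsto_nhdsWithin_of_tendsto_nhds (Continuous.tendsto (by fun_prop) 0)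
    rw [zero_mul] at hlim
    exact hlim.congr' (hmem.mono fun t ht ↦ (hγ t ht).2.1.symm)
  have hlim : Tendsto (fun t ↦ g z (Φ (γ t))) (𝓝[>] 0) (𝓝 (g z (Φ x))) := by
    have hgz : Continuous (fun y ↦ g z y) := by fun_prop
    exact (hgz.tendsto _).comp ((hΦc x hx).tendsto.comp hγx)
  refine ge_of_tendsto hlim ?_
  filter_upwards [Ioc_mem_nhdsGT (zero_lt_one' ℝ)] with t ht
  obtain ⟨hmem, -, hc⟩ := hγ t ⟨ht.1.le, ht.2⟩
  have h1 : g x (Φ x) ≤ g (γ t) (Φ (γ t)) := hmin hmem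
  have h2 := hc _ (hΦY _ hmem)
  have h3 := mul_le_mul_of_nonneg_left (hΦmax x hx _ (hΦY _ hmem)) (sub_nonneg.2 ht.2)
  have h4 : 0 ≤ μ / 2 * (t * (1 - t)) * dist x z ^ 2 := by
    have := sub_nonneg.2 ht.2
    have := ht.1.le
    positivity
  refine le_of_mul_le_mul_left ?_ ht.1
  linarith

end IsMetricStronglyConvex

end MinMax

/-! ### Attained suprema and infima. -/

section Gaps

variable {M N : Type*}

theorem sSup_image_eq_of_isMaxOn {Y : Set N} {f : N → ℝ} {y : N} (hy : y ∈ Y)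
    (hmax : IsMaxOn f Y y) : sSup (f '' Y) = f y :=
  IsGreatest.csSup_eq ⟨mem_image_of_mem f hy, forall_mem_image.2 fun _ hz ↦ hmax hz⟩

theorem sInf_image_eq_of_isMinOn {X : Set M} {f : M → ℝ} {x : M} (hx : x ∈ X)
    (hmin : IsMinOn f X x) : sInf (f '' X) = f x :=
  IsLeast.csInf_eq ⟨mem_image_of_mem f hx, forall_mem_image.2 fun _ hz ↦ hmin hz⟩

end Gaps

/-! ### From gradients to the metric form of strong convexity. -/

section OneManifold

variable {E : Type*} [NormedAddCommGroup E] [NormedSpace ℝ E] [FiniteDimensional ℝ E]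
  {M : Type*} [MetricSpace M] [ChartedSpace E M]
  [RiemannianBundle (fun x : M ↦ TangentSpace 𝓘(ℝ, E) x)]

/-- Minimizers of two strongly g-convex functions are close if their gradients are. -/
theorem StronglyGConvexOn.mul_dist_le {μ : ℝ} {X : Set M} (hX : GConvex E X) {f h : M → ℝ}
    (hfd : MDifferentiable 𝓘(ℝ, E) 𝓘(ℝ, ℝ) f) (hhd : MDifferentiable 𝓘(ℝ, E) 𝓘(ℝ, ℝ) h)
    (hf : StronglyGConvexOn E μ X f) (hh : StronglyGConvexOn E μ X h) {C : ℝ} (hC0 : 0 ≤ C)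
    (hC : ∀ x ∈ X, ‖riemGradient E f x - riemGradient E h x‖ ≤ C) {x x' : M} (hx : x ∈ X)
    (hx' : x' ∈ X) (hmin : IsMinOn f X x) (hmin' : IsMinOn h X x') : μ * dist x x' ≤ C := by
  rcases eq_or_ne x x' with rfl | hne
  · simpa using hC0
  obtain ⟨γ, hγ, hγX⟩ := hX x hx x' hx'
  obtain ⟨σ, hσ, hσX⟩ := hX x' hx' x hx
  have h1 := quadratic_growth_of_isMinOn hmin hγX fun t ht ↦ hf.le_of_isGeodesic hγ hγX ht
  have h2 := quadratic_growth_of_isMinOn hmin' hσX fun t ht ↦ hh.le_of_isGeodesic hσ hσX ht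
  -- Adding `h1` and `h2` bounds `μ * d²` by the increment of `f - h` from `x` to `x'`, which is at
  -- most `C * d`.
  have h3 := (abs_le.1 (hγ.abs_sub_sub_le hfd hhd fun t ht ↦ hC _ (hγX t ht))).2
  rw [dist_comm x' x] at h2
  refine le_of_mul_le_mul_right ?_ (dist_pos.2 hne)
  linarith

/-- Geodesic strong convexity, with gradients depending in a Lipschitz way on a parameter,
gives strong convexity in the metric sense. -/
theorem isMetricStronglyConvex_of_stronglyGConvexOn {N : Type*} [MetricSpace N] {μ : ℝ} {L : ℝ≥0}
    (hμ : 0 < μ) {X : Set M} (hX : GConvex E X) {Y : Set N} {g : M → N → ℝ}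
    (hd : ∀ y ∈ Y, MDifferentiable 𝓘(ℝ, E) 𝓘(ℝ, ℝ) (fun x ↦ g x y))
    (hg : ∀ y ∈ Y, StronglyGConvexOn E μ X (fun x ↦ g x y))
    (hL : ∀ x ∈ X, ∀ y ∈ Y, ∀ y' ∈ Y,
      ‖riemGradient E (fun z ↦ g z y) x - riemGradient E (fun z ↦ g z y') x‖ ≤ L * dist y y') :
    IsMetricStronglyConvex μ L X Y g where
  segment x hx x' hx' := by
    obtain ⟨γ, hγ, hγX⟩ := hX x hx x' hx'
    refine ⟨γ, fun t ht ↦ ⟨hγX t ht, ?_, fun y hy ↦ (hg y hy).le_of_isGeodesic hγ hγX ht⟩⟩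
    have := hγ.dist_eq t ht 0 ⟨le_rfl, zero_le_one⟩
    rwa [sub_zero, abs_of_nonneg ht.1, hγ.source] at this
  bddBelow y hy := (hg y hy).bddBelow hμ hX
  dist_le y hy y' hy' x hx x' hx' hmin hmin' :=
    StronglyGConvexOn.mul_dist_le hX (hd y hy) (hd y' hy') (hg y hy) (hg y' hy') (by positivity)
      (fun z hz ↦ hL z hz y hy y' hy') hx hx' hmin hmin'

end OneManifold

end RiemannianMinMax

/-! ### The gap estimates. -/

theorem mainTheorem9
    {E : Type*} [NormedAddCommGroup E] [NormedSpace ℝ E] [FiniteDimensional ℝ E]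
    {M : Type*} [MetricSpace M] [ChartedSpace E M] [IsManifold 𝓘(ℝ, E) ∞ M]
    [RiemannianBundle (fun x : M ↦ TangentSpace 𝓘(ℝ, E) x)]
    [IsContMDiffRiemannianBundle 𝓘(ℝ, E) ∞ E (fun x : M ↦ TangentSpace 𝓘(ℝ, E) x)]
    {F : Type*} [NormedAddCommGroup F] [NormedSpace ℝ F] [FiniteDimensional ℝ F]
    {N : Type*} [MetricSpace N] [ChartedSpace F N] [IsManifold 𝓘(ℝ, F) ∞ N]
    [RiemannianBundle (fun y : N ↦ TangentSpace 𝓘(ℝ, F) y)]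
    [IsContMDiffRiemannianBundle 𝓘(ℝ, F) ∞ F (fun y : N ↦ TangentSpace 𝓘(ℝ, F) y)]
    (hM : IsHadamard E M) (hN : IsHadamard F N)
    (X : Set M) (hXc : IsClosed X) (hX : GConvex E X) (hXne : X.Nonempty)
    (Y : Set N) (hYc : IsClosed Y) (hY : GConvex F Y) (hYne : Y.Nonempty)
    (μx μy : ℝ) (hμx : 0 < μx) (hμy : 0 < μy) (Lx Ly Lxy : ℝ≥0)
    (g : M → N → ℝ) (hg : IsSmoothSCSC E F μx μy Lx Ly Lxy X Y g) :
    -- the notions in the claims below are well defined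
    (∀ y ∈ Y, ∃! x, x ∈ X ∧ IsMinOn (fun z ↦ g z y) X x) ∧
    (∀ x ∈ X, ∃! y, y ∈ Y ∧ IsMaxOn (fun z ↦ g x z) Y y) ∧
    (∃! p : M × N, p.1 ∈ X ∧ p.2 ∈ Y ∧ IsSaddlePointOn X Y g p.1 p.2) ∧
    ∀ xs ∈ X, ∀ ys ∈ Y, IsSaddlePointOn X Y g xs ys → ∀ a ∈ X, ∀ b ∈ Y,
      -- full gap to one gap
      (gapX g Y xs ys a ≤ gap g X Y a b ∧ gapY g X xs ys b ≤ gap g X Y a b) ∧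
      -- one gap to one distance
      (dist a xs ^ 2 ≤ 2 / μx * gapX g Y xs ys a ∧ dist b ys ^ 2 ≤ 2 / μy * gapY g X xs ys b) ∧
      -- one gap to distance, with an approximate minimizer in the other variable
      (∀ ε ε' : ℝ, gapY g X xs ys b ≤ ε → ∀ a', IsApproxMinOn ε' (fun x ↦ g x b) X a' →
        dist a' xs ^ 2 + dist b ys ^ 2 ≤
          4 * ε' / μx + 2 * ε / μy * (2 * (Lxy : ℝ) ^ 2 / μx ^ 2 + 1)) ∧
      -- distance to gap
      (∀ Kx Ky : ℝ≥0, LipschitzOnWith Kx (fun x ↦ g x b) X →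
        LipschitzOnWith Ky (fun y ↦ g a y) Y →
        gap g X Y a b ≤ dist ys b * (Ky + Kx * (Lxy / μx)) + dist xs a * (Kx + Ky * (Lxy / μy))) := by
  have hgc : Continuous (fun p : M × N ↦ g p.1 p.2) := hg.differentiable.continuous
  have hdx : ∀ y, MDifferentiable 𝓘(ℝ, E) 𝓘(ℝ, ℝ) (fun x ↦ g x y) := fun y ↦
    hg.differentiable.comp (mdifferentiable_id.prodMk (mdifferentiable_const (c := y)))
  have hdy : ∀ x, MDifferentiable 𝓘(ℝ, F) 𝓘(ℝ, ℝ) (fun y ↦ g x y) := fun x ↦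
    hg.differentiable.comp ((mdifferentiable_const (c := x)).prodMk mdifferentiable_id)
  have hgX : IsMetricStronglyConvex μx Lxy X Y g :=
    isMetricStronglyConvex_of_stronglyGConvexOn hμx hX (fun y _ ↦ hdx y) hg.stronglyConvex
      hg.lipschitz_xy
  have hgY : IsMetricStronglyConvex μy Lxy Y X (fun y x ↦ -g x y) := by
    refine isMetricStronglyConvex_of_stronglyGConvexOn hμy hY (fun x _ ↦ (hdy x).neg)
      hg.stronglyConcave fun y hy x hx x' hx' ↦ ?_
    rw [riemGradient_neg, riemGradient_neg, ← neg_sub', norm_neg]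
    exact hg.lipschitz_yx y hy x hx x' hx'
  have := hM.complete
  have := hN.complete
  have hminX : ∀ y ∈ Y, ∃! x, x ∈ X ∧ IsMinOn (fun z ↦ g z y) X x := fun y hy ↦
    hgX.existsUnique_isMinOn hμx hXc.isComplete hXne hy (Continuous.continuousOn (by fun_prop))
  have hneg : ∀ x y, IsMinOn (fun z ↦ -g x z) Y y ↔ IsMaxOn (fun z ↦ g x z) Y y := fun x y ↦ by
    simp only [isMinOn_iff, isMaxOn_iff, neg_le_neg_iff]
  have hmaxY : ∀ x ∈ X, ∃! y, y ∈ Y ∧ IsMaxOn (fun z ↦ g x z) Y y := by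
    intro x hx
    simp only [← hneg]
    exact hgY.existsUnique_isMinOn hμy hYc.isComplete hYne hx
      (Continuous.continuousOn (by fun_prop))
  have hsX : ∀ {x y}, y ∈ Y → IsSaddlePointOn X Y g x y → IsMinOn (fun z ↦ g z y) X x :=
    fun hy h z hz ↦ h z hz _ hy
  have hsY : ∀ {x y}, x ∈ X → IsSaddlePointOn X Y g x y → IsMaxOn (fun z ↦ g x z) Y y :=
    fun hx h z hz ↦ h _ hx z hz
  refine ⟨hminX, hmaxY, ?_, ?_⟩
  · obtain ⟨x, hx, y, hy, hs⟩ := hgX.exists_isSaddlePointOn hgY hμx hμy hgc hXc.isComplete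
      hYc.isComplete hXne hYne
    refine ⟨(x, y), ⟨hx, hy, hs⟩, ?_⟩
    rintro ⟨x', y'⟩ ⟨hx', hy', hs'⟩
    -- Saddle points are interchangeable, so `x`, `x'` both minimize `g · y` and `y`, `y'` both
    -- maximize `g x ·`.
    have hxy' : IsSaddlePointOn X Y g x' y := hs'.swap_left hx hy' hs
    have hx'y : IsSaddlePointOn X Y g x y' := hs.swap_left hx' hy hs'
    exact Prod.ext ((hminX y hy).unique ⟨hx', hsX hy hxy'⟩ ⟨hx, hsX hy hs⟩)
      ((hmaxY x hx).unique ⟨hy', hsY hx hx'y⟩ ⟨hy, hsY hx hs⟩)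
  intro xs hxs ys hys hs a ha b hb
  obtain ⟨xb, ⟨hxb, hxbmin⟩, -⟩ := hminX b hb
  obtain ⟨ya, ⟨hya, hyamax⟩, -⟩ := hmaxY a ha
  have hsup : sSup ((fun y ↦ g a y) '' Y) = g a ya := sSup_image_eq_of_isMaxOn hya hyamax
  have hinf : sInf ((fun x ↦ g x b) '' X) = g xb b := sInf_image_eq_of_isMinOn hxb hxbmin
  simp only [gap, gapX, gapY, IsApproxMinOn, hsup, hinf]
  -- The chain `g xb b ≤ g xs b ≤ g xs ys ≤ g a ys ≤ g a ya` yields the comparison of gaps.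
  have hxbs : g xb b ≤ g xs b := hxbmin hxs
  have hyas : g a ys ≤ g a ya := hyamax hys
  have hsb : g xs b ≤ g xs ys := hsY hxs hs hb
  have hsa : g xs ys ≤ g a ys := hsX hys hs ha
  have hgrowx := hgX.quadratic_growth hys hxs ha (hsX hys hs)
  have hgrowy := hgY.quadratic_growth hxs hys hb ((hneg _ _).2 (hsY hxs hs))
  have hdistx : dist xb xs ≤ Lxy / μx * dist ys b := by
    rw [div_mul_eq_mul_div, le_div_iff₀' hμx, dist_comm ys]
    exact hgX.dist_le b hb ys hys xb hxb xs hxs hxbmin (hsX hys hs)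
  have hdisty : dist ya ys ≤ Lxy / μy * dist xs a := by
    rw [div_mul_eq_mul_div, le_div_iff₀' hμy, dist_comm xs]
    exact hgY.dist_le a ha xs hxs ya hya ys hys ((hneg _ _).2 hyamax) ((hneg _ _).2 (hsY hxs hs))
  have hdistb : dist b ys ^ 2 ≤ 2 / μy * (g xs ys - g xb b) := by
    rw [div_mul_eq_mul_div, le_div_iff₀' hμy]
    linarith
  refine ⟨⟨by linarith, by linarith⟩, ⟨?_, hdistb⟩, ?_, ?_⟩
  · rw [div_mul_eq_mul_div, le_div_iff₀' hμx]
    linarith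
  · rintro ε ε' hε a' ⟨ha', hε'⟩
    have hgrow := hgX.quadratic_growth hb hxb ha' hxbmin
    have h1 : dist a' xb ^ 2 ≤ 2 / μx * ε' := by
      rw [div_mul_eq_mul_div, le_div_iff₀' hμx]
      linarith
    have h2 : dist b ys ^ 2 ≤ 2 / μy * ε := hdistb.trans (by gcongr)
    have h3 : dist xb xs ^ 2 ≤ (Lxy / μx) ^ 2 * (2 / μy * ε) := by
      calc dist xb xs ^ 2 ≤ (Lxy / μx * dist ys b) ^ 2 := by gcongr
        _ = (Lxy / μx) ^ 2 * dist b ys ^ 2 := by rw [mul_pow, dist_comm]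
        _ ≤ _ := by gcongr
    -- Passing through `xb`, the exact minimizer for `b`; squaring the triangle inequality costs the
    -- factor `2`.
    have h4 : dist a' xs ^ 2 ≤ 2 * (dist a' xb ^ 2 + dist xb xs ^ 2) :=
      (pow_le_pow_left₀ dist_nonneg (dist_triangle _ _ _) 2).trans add_sq_le
    calc dist a' xs ^ 2 + dist b ys ^ 2
        ≤ 2 * (2 / μx * ε' + (Lxy / μx) ^ 2 * (2 / μy * ε)) + 2 / μy * ε := by linarith
      _ = _ := by ring
  · intro Kx Ky hKx hKy
    -- The gap is split at `g a b`, so that each half varies one argument only.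
    have h1 : g a b - g xb b ≤ Kx * dist a xb :=
      (le_abs_self _).trans (hKx.dist_le_mul a ha xb hxb)
    have h2 : g a ya - g a b ≤ Ky * dist ya b :=
      (le_abs_self _).trans (hKy.dist_le_mul ya hya b hb)
    have h3 : dist a xb ≤ dist xs a + Lxy / μx * dist ys b := by
      linarith [dist_triangle_right a xb xs, dist_comm a xs, dist_comm xb xs]
    have h4 : dist ya b ≤ Lxy / μy * dist xs a + dist ys b := by
      linarith [dist_triangle ya ys b]
    calc g a ya - g xb b ≤ Kx * dist a xb + Ky * dist ya b := by linarith
      _ ≤ Kx * (dist xs a + Lxy / μx * dist ys b) + Ky * (Lxy / μy * dist xs a + dist ys b) := by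
        gcongr
      _ = _ := by ring
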